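/- Let $n,m\in\mathbb N$, let $D_X\in\mathbb R^{n\times n}$ and $D_Y\in\mathbb R^{m\times m}$ be symmetric matrices, and let $\mu\in\mathbb R^n$, $\nu\in\mathbb R^m$ be probability vectors (nonnegative entries summing to $1$). Equip $\mathbb R^{n\times m}$ with the Frobenius inner product and norm, and put $$f(\pi)=-\operatorname{Tr}(D_X\pi D_Y\pi^T),\qquad C_1=\{\pi\ge 0:\pi\mathbf 1_m=\mu\},\qquad C_2=\{\pi\ge 0:\pi^T\mathbf 1_n=\nu\}.$$ For a convex set $C$ and $x\in C$ let $\mathcal N_C(x)=\{v:\langle v,y-x\rangle\le 0\ \text{for all } y\in C\}$, and $\mathcal N_C(x)=\emptyset$ for $x\notin C$. The critical set of the Gromov–Wasserstein (GW) problem $\min_{\pi\in C_1\cap C_2}f(\pi)$ is $$\mathcal X=\{\pi\in C_1\cap C_2: 0\in\nabla f(\pi)+\mathcal N_{C_1}(\pi)+\mathcal N_{C_2}(\pi)\}.$$ Let $\sigma>0$. Then $\mathcal X\neq\emptyset$, and there are constants $\tau_1,\tau_2$, depending only on $D_X,D_Y,\mu,\nu,\sigma$, such that the following holds for every $\rho>0$,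 every open convex set $D\subseteq\mathbb R^{n\times m}$ and every function $h$ that is differentiable on $D$ and $\sigma$-strongly convex on $D\cap\operatorname{conv}(C_1\cup C_2)$ (for a Legendre kernel $h$, $D$ is the interior of its domain; for instance $D=\mathbb R^{n\times m}$ for $h(x)=\tfrac12\|x\|^2$ and $D=(0,\infty)^{n\times m}$ for $h(x)=\sum_{ij}x_{ij}\log x_{ij}$). Let $(\pi^\star,w^\star)\in D\times D$ be a fixed point of Bregman Alternating Projected Gradient (BAPG) with kernel $h$ and parameter $\rho$, that is, suppose there are $p\in\mathcal N_{C_1}(\pi^\star)$ and $q\in\mathcal N_{C_2}(w^\star)$ with $$\nabla f(w^\star)+\rho\,(\nabla h(\pi^\star)-\nabla h(w^\star))+p=0,\qquad \nabla f(\pi^\star)+\rho\,(\nabla h(w^\star)-\nabla h(\pi^\star))+q=0.$$ Then $$\|\pi^\star-w^\star\|\le\frac{\tau_1}{\rho}\qquad\text{and}\qquad \operatorname{dist}\!\left(\frac{\pi^\star+w^\star}{2},\mathcal X\right)\le\frac{\tau_2}{\rho}.$$ -/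

import Mathlib

noncomputable section

namespace GW

/-- The space `ℝ^{n × m}` with the Frobenius (Euclidean) norm and inner product. -/
abbrev Coupling (n m : ℕ) : Type := EuclideanSpace ℝ (Fin n × Fin m)

/-- The `n × m` matrix of entries of `π`. -/
def toMat {n m : ℕ} (π : Coupling n m) : Matrix (Fin n) (Fin m) ℝ :=
  Matrix.of fun i j => π (i, j)

/-- The Gromov–Wasserstein objective `f(π) = -Tr(D_X π D_Y πᵀ)`. -/
def objective {n m : ℕ} (DX : Matrix (Fin n) (Fin n) ℝ) (DY : Matrix (Fin m) (Fin m) ℝ)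
    (π : Coupling n m) : ℝ :=
  -(DX * toMat π * DY * (toMat π).transpose).trace

/-- `C₁ = {π ≥ 0 : π 1_m = μ}`. -/
def rowSet {n : ℕ} (m : ℕ) (μ : Fin n → ℝ) : Set (Coupling n m) :=
  {π | (∀ i j, 0 ≤ π (i, j)) ∧ ∀ i, ∑ j, π (i, j) = μ i}

/-- `C₂ = {π ≥ 0 : πᵀ 1_n = ν}`. -/
def colSet (n : ℕ) {m : ℕ} (ν : Fin m → ℝ) : Set (Coupling n m) :=
  {π | (∀ i j, 0 ≤ π (i, j)) ∧ ∀ j, ∑ i, π (i, j) = ν j}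

/-- The normal cone to a convex set `C` at `x` (empty when `x ∉ C`). -/
def normalCone {E : Type*} [NormedAddCommGroup E] [InnerProductSpace ℝ E]
    (C : Set E) (x : E) : Set E :=
  {v | x ∈ C ∧ ∀ y ∈ C, inner ℝ v (y - x) ≤ 0}

/-- The critical set `{π ∈ C₁ ∩ C₂ : 0 ∈ ∇f(π) + N_{C₁}(π) + N_{C₂}(π)}`. -/
def criticalSet {n m : ℕ} (DX : Matrix (Fin n) (Fin n) ℝ) (DY : Matrix (Fin m) (Fin m) ℝ)
    (μ : Fin n → ℝ) (ν : Fin m → ℝ) : Set (Coupling n m) :=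
  {π | π ∈ rowSet m μ ∩ colSet n ν ∧
    ∃ p ∈ normalCone (rowSet m μ) π, ∃ q ∈ normalCone (colSet n ν) π,
      gradient (objective DX DY) π + p + q = 0}

/-- The fixed-point set of BAPG with kernel `h` and parameter `ρ`. -/
def fixedPointSet {n m : ℕ} (DX : Matrix (Fin n) (Fin n) ℝ) (DY : Matrix (Fin m) (Fin m) ℝ)
    (μ : Fin n → ℝ) (ν : Fin m → ℝ) (h : Coupling n m → ℝ) (ρ : ℝ) :
    Set (Coupling n m × Coupling n m) :=
  {z | ∃ p ∈ normalCone (rowSet m μ) z.1, ∃ q ∈ normalCone (colSet n ν) z.2,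
    gradient (objective DX DY) z.2 + ρ • (gradient h z.1 - gradient h z.2) + p = 0 ∧
    gradient (objective DX DY) z.1 + ρ • (gradient h z.2 - gradient h z.1) + q = 0}

end GW

end

/-! The objective is quadratic, so its gradient is a linear map `G`, and the sets involved are
polyhedral. Adding the two fixed-point equations cancels `h` and leaves `G π + G w + p + q = 0`:
after halving, the midpoint is critical except that the normals sit at `π` and `w`.

The gap is controlled by testing `p` and `q` against a common feasible `z` near `π`
(`exists_mem_inter_norm_sub_le`). The kernel terms combine to `⟨∇h π - ∇h w, π - w⟩`, which strong
monotonicity bounds below by `σ‖π - w‖²`, while the gradient terms are linear in `‖π - w‖`.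

For the distance to the critical set, fix the zero patterns of `π` and `w`. Sufficient conditions
for criticality then form a finite linear system that the midpoint solves up to a multiple of `‖π -
w‖`. Hoffman's bound gives a nearby exact solution; an inconsistent system admits no small residual.
Finitely many patterns yield one constant (`exists_critical_near`). The same lemma, applied to a
penalised minimiser, shows that critical points exist. -/

open Filter Topology

namespace GW

/-! ### Hoffman's error bound and approximate linear systems -/

section Hoffman

variable {E : Type*} [NormedAddCommGroup E] [InnerProductSpace ℝ E] [FiniteDimensional ℝ E]
variable {ι : Type*} [Finite ι]

/-- On the polar of the cone `{v | ∀ k ∈ A, ℓ k v ≤ 0}`, the norm is controlled by the positive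
part of the functionals `ℓ k`, `k ∈ A`. -/
lemma exists_norm_le_of_mem_polar (ℓ : ι → E →L[ℝ] ℝ) (A : Set ι) :
    ∃ κ : ℝ, 0 ≤ κ ∧ ∀ d : E, (∀ v, (∀ k ∈ A, ℓ k v ≤ 0) → inner ℝ d v ≤ 0) →
      ∀ r : ℝ, 0 ≤ r → (∀ k ∈ A, ℓ k d ≤ r) → ‖d‖ ≤ κ * r := by
  classical
  have := Fintype.ofFinite ι
  set g : E → ℝ := fun d => ∑ k, if k ∈ A then max (ℓ k d) 0 else 0 with hg
  set K : Set E := Metric.sphere 0 1 ∩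
    {d | ∀ v, (∀ k ∈ A, ℓ k v ≤ 0) → inner ℝ d v ≤ 0} with hK
  have hgc : Continuous g := by
    refine continuous_finsetSum _ fun k _ => ?_
    split_ifs <;> fun_prop
  have hterm : ∀ d k, 0 ≤ (if k ∈ A then max (ℓ k d) 0 else 0) := by
    intro d k; split_ifs <;> simp
  have hgpos : ∀ d ∈ K, 0 < g d := by
    intro d hd
    refine lt_of_le_of_ne (Finset.sum_nonneg fun k _ => hterm d k) fun h0 => ?_
    have h1 := (Finset.sum_eq_zero_iff_of_nonneg fun k _ => hterm d k).1 h0.symm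
    -- Vanishing positive parts put `d` in the cone itself, so polarity can be tested at `v = d`.
    have h2 : inner ℝ d d ≤ 0 := hd.2 d fun k hk => by
      have := h1 k (Finset.mem_univ k)
      rw [if_pos hk] at this
      exact this ▸ le_max_left _ _
    rw [real_inner_self_eq_norm_sq, mem_sphere_zero_iff_norm.1 hd.1] at h2
    norm_num at h2
  have hKc : IsCompact K := by
    refine (isCompact_sphere 0 1).inter_right ?_
    simp only [Set.ofPred_forall]
    exact isClosed_iInter fun v => isClosed_iInter fun _ =>
      isClosed_le (by fun_prop) continuous_const
  have hmem : ∀ d : E, d ≠ 0 → (∀ v, (∀ k ∈ A, ℓ k v ≤ 0) → inner ℝ d v ≤ 0) →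
      ‖d‖⁻¹ • d ∈ K := by
    intro d hd hv
    refine ⟨by simp [norm_smul, hd], fun v hv' => ?_⟩
    rw [real_inner_smul_left]
    exact mul_nonpos_of_nonneg_of_nonpos (by positivity) (hv v hv')
  rcases K.eq_empty_or_nonempty with h0 | hne
  · refine ⟨0, le_rfl, fun d hd r hr _ => ?_⟩
    by_cases h : d = 0
    · simp [h]
    · exact absurd (hmem d h hd) (by simp [h0])
  obtain ⟨e, he, hmin⟩ := hKc.exists_isMinOn hne hgc.continuousOn
  have hγ := hgpos e he
  refine ⟨Fintype.card ι / g e, by positivity, fun d hd r hr hA => ?_⟩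
  by_cases h : d = 0
  · simp only [h, norm_zero]; positivity
  have h1 : g e ≤ g (‖d‖⁻¹ • d) := hmin (hmem d h hd)
  have hn : 0 < ‖d‖ := norm_pos_iff.2 h
  have h2 : g (‖d‖⁻¹ • d) ≤ Fintype.card ι * (‖d‖⁻¹ * r) := by
    have : g (‖d‖⁻¹ • d) ≤ ∑ _k : ι, (‖d‖⁻¹ * r) := by
      refine Finset.sum_le_sum fun k _ => ?_
      split_ifs with hk
      · refine max_le ?_ (by positivity)
        simp only [map_smul, smul_eq_mul]
        exact mul_le_mul_of_nonneg_left (hA k hk) (by positivity)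
      · positivity
    simpa using this
  have h3 := h1.trans h2
  rw [div_mul_eq_mul_div, le_div_iff₀ hγ]
  calc ‖d‖ * g e ≤ ‖d‖ * (Fintype.card ι * (‖d‖⁻¹ * r)) := by gcongr
    _ = Fintype.card ι * r := by field_simp

/-- **Hoffman's error bound**, with a constant independent of the right-hand side. -/
lemma hoffman_bound (ℓ : ι → E →L[ℝ] ℝ) :
    ∃ κ : ℝ, 0 ≤ κ ∧ ∀ c : ι → ℝ, (∃ y, ∀ k, ℓ k y ≤ c k) →
      ∀ (z : E) (r : ℝ), 0 ≤ r → (∀ k, ℓ k z ≤ c k + r) →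
        ∃ y, (∀ k, ℓ k y ≤ c k) ∧ ‖z - y‖ ≤ κ * r := by
  choose κ hκ0 hκ using exists_norm_le_of_mem_polar ℓ
  -- There are finitely many possible active sets, hence a constant that does not see `c`.
  obtain ⟨B, hB⟩ := (Set.finite_range κ).bddAbove
  refine ⟨max B 0, le_max_right _ _, fun c hne z r hr hz => ?_⟩
  set S : Set E := {y | ∀ k, ℓ k y ≤ c k} with hS
  have hSc : IsClosed S := by
    simp only [hS, Set.ofPred_forall]
    exact isClosed_iInter fun k => isClosed_le (by fun_prop) continuous_const
  have hSconv : Convex ℝ S := by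
    simp only [hS, Set.ofPred_forall]
    exact convex_iInter fun k => convex_halfSpace_le (ℓ k).toLinearMap.isLinear _
  have hSne : S.Nonempty := hne
  obtain ⟨y, hyS, hy⟩ := exists_norm_eq_iInf_of_complete_convex hSne hSc.isComplete hSconv z
  rw [norm_eq_iInf_iff_real_inner_le_zero hSconv hyS] at hy
  refine ⟨y, hyS, ?_⟩
  have h := hκ {k | ℓ k y = c k} (z - y) (fun v hv => ?_) r hr fun k hk => ?_
  · refine h.trans (mul_le_mul_of_nonneg_right ?_ hr)
    exact (hB ⟨_, rfl⟩).trans (le_max_left _ _)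
  -- Inactive constraints tolerate a short step along `v`, so the projection inequality puts `z - y`
  -- in the polar of the active cone.
  · have hev : ∀ᶠ t : ℝ in 𝓝[>] 0, ∀ k, ℓ k (y + t • v) ≤ c k := by
      refine eventually_all.2 fun k => ?_
      by_cases hk : ℓ k y = c k
      · filter_upwards [self_mem_nhdsWithin] with t ht
        have := mul_nonpos_of_nonneg_of_nonpos (le_of_lt ht) (hv k hk)
        simp only [map_add, map_smul, smul_eq_mul]
        linarith
      · have hlt : ℓ k (y + (0 : ℝ) • v) < c k := by simpa using lt_of_le_of_ne (hyS k) hk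
        have hcont : Continuous fun t : ℝ => ℓ k (y + t • v) := by fun_prop
        exact ((hcont.tendsto 0).eventually (gt_mem_nhds hlt)).filter_mono nhdsWithin_le_nhds
          |>.mono fun t ht => ht.le
    obtain ⟨t, ht, ht0⟩ := (hev.and self_mem_nhdsWithin).exists
    have := hy _ ht
    rw [add_sub_cancel_left, real_inner_smul_right] at this
    exact nonpos_of_mul_nonpos_right this ht0
  · have h1 : ℓ k y = c k := hk
    rw [map_sub, h1]
    linarith [hz k]

/-- A linear system all of whose relaxations are solvable is solvable. -/
lemma exists_solution_of_relaxations (ℓ : ι → E →L[ℝ] ℝ) (c : ι → ℝ)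
    (h : ∀ r : ℝ, 0 < r → ∃ z, ∀ k, ℓ k z ≤ c k + r) : ∃ y, ∀ k, ℓ k y ≤ c k := by
  obtain ⟨κ, -, hκ⟩ := hoffman_bound ℓ
  obtain ⟨z, hz⟩ := h 1 one_pos
  have hr : ∀ j : ℕ, (0 : ℝ) < 1 / ((j : ℝ) + 1) := fun j => by positivity
  -- Uniformity of `κ` in the right-hand side keeps solutions of all the relaxations in one ball,
  -- where compactness applies.
  have : ∀ j : ℕ, ∃ y, (∀ k, ℓ k y ≤ c k + 1 / ((j : ℝ) + 1)) ∧ ‖z - y‖ ≤ κ * 1 := fun j =>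
    hκ (fun k => c k + 1 / ((j : ℝ) + 1)) (h _ (hr j)) z 1 zero_le_one fun k => by
      linarith [hz k, hr j]
  choose y hy hyb using this
  obtain ⟨x, -, φ, hφ, hx⟩ := (isCompact_closedBall z (κ * 1)).tendsto_subseq
    (x := y) fun j => by simpa [dist_eq_norm, norm_sub_rev] using hyb j
  refine ⟨x, fun k => ?_⟩
  have h1 : Tendsto (fun j => ℓ k (y (φ j))) atTop (𝓝 (ℓ k x)) :=
    ((ℓ k).continuous.tendsto x).comp hx
  have h2 : Tendsto (fun j => c k + 1 / ((φ j : ℝ) + 1)) atTop (𝓝 (c k + 0)) :=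
    (tendsto_one_div_add_atTop_nhds_zero_nat.comp hφ.tendsto_atTop).const_add (c k)
  simpa using le_of_tendsto_of_tendsto' h1 h2 fun j => hy (φ j) k

end Hoffman

/-- Every sufficiently accurate approximate solution of a finite system of linear inequalities
is close to an exact solution, to first order in the residual. -/
lemma approx_solution_bound {E : Type*} [NormedAddCommGroup E] [NormedSpace ℝ E]
    [FiniteDimensional ℝ E] {ι : Type*} [Finite ι] (ℓ : ι → E →ₗ[ℝ] ℝ) (c : ι → ℝ) :
    ∀ᶠ C : ℝ in atTop, ∀ (z : E) (r : ℝ), 0 ≤ r → C * r < 1 → (∀ k, ℓ k z ≤ c k + r) →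
      ∃ y, (∀ k, ℓ k y ≤ c k) ∧ ‖z - y‖ ≤ C * r := by
  by_cases hne : ∃ y, ∀ k, ℓ k y ≤ c k
  · let e := toEuclidean (E := E)
    obtain ⟨κ, hκ0, hκ⟩ := hoffman_bound
      (fun k => (LinearMap.toContinuousLinearMap (ℓ k)).comp e.symm.toContinuousLinearMap)
    filter_upwards [eventually_ge_atTop (‖e.symm.toContinuousLinearMap‖ * κ)] with C hC z r hr _ hz
    obtain ⟨y, hy, hyz⟩ := hκ c (hne.imp' e fun y hy => by simpa using hy) (e z) r hr
      (by simpa using hz)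
    refine ⟨e.symm y, by simpa using hy, ?_⟩
    calc ‖z - e.symm y‖ = ‖e.symm.toContinuousLinearMap (e z - y)‖ := by simp
      _ ≤ ‖e.symm.toContinuousLinearMap‖ * (κ * r) :=
        (ContinuousLinearMap.le_opNorm _ _).trans (by gcongr)
      _ ≤ C * r := by rw [← mul_assoc]; gcongr
  · let e := toEuclidean (E := E)
    have h : ∃ r : ℝ, 0 < r ∧ ∀ z : E, ¬ ∀ k, ℓ k z ≤ c k + r := by
      by_contra! hcon
      refine hne ?_
      obtain ⟨y, hy⟩ := exists_solution_of_relaxations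
        (fun k => (LinearMap.toContinuousLinearMap (ℓ k)).comp e.symm.toContinuousLinearMap) c
        fun r hr => (hcon r hr).imp' e fun y hy => by simpa using hy
      exact ⟨e.symm y, by simpa using hy⟩
    obtain ⟨r₀, hr₀, hz₀⟩ := h
    -- With `C ≥ r₀⁻¹`, the condition `C * r < 1` forces `r < r₀`, a residual that the inconsistent
    -- system excludes.
    filter_upwards [eventually_ge_atTop r₀⁻¹] with C hC z r hr hCr hz
    refine absurd (fun k => (hz k).trans ?_) (hz₀ z)
    have : r₀⁻¹ * r < 1 := (mul_le_mul_of_nonneg_right hC hr).trans_lt hCr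
    rw [inv_mul_lt_one₀ hr₀] at this
    linarith

/-! ### First-order optimality and strong monotonicity -/

lemma neg_gradient_mem_normalCone {E : Type*} [NormedAddCommGroup E] [InnerProductSpace ℝ E]
    [CompleteSpace E] {C : Set E} (hC : Convex ℝ C) {φ : E → ℝ} {x g : E} (hx : x ∈ C)
    (hmin : IsMinOn φ C x) (hg : HasGradientAt φ g x) : -g ∈ normalCone C x := by
  refine ⟨hx, fun y hy => ?_⟩
  have h := hmin.localize.hasFDerivWithinAt_nonneg hg.hasFDerivAt.hasFDerivWithinAt
    (sub_mem_posTangentConeAt_of_segment_subset (hC.segment_subset hx hy))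
  simpa using h

lemma smul_mem_normalCone {E : Type*} [NormedAddCommGroup E] [InnerProductSpace ℝ E]
    {C : Set E} {x v : E} (hv : v ∈ normalCone C x) {t : ℝ} (ht : 0 ≤ t) :
    t • v ∈ normalCone C x := by
  refine ⟨hv.1, fun y hy => ?_⟩
  rw [real_inner_smul_left]
  exact mul_nonpos_of_nonneg_of_nonpos ht (hv.2 y hy)

/-- A differentiable strongly convex function has a strongly monotone gradient. -/
lemma strongConvexOn_gradient_monotone {E : Type*} [NormedAddCommGroup E]
    [InnerProductSpace ℝ E] [CompleteSpace E] {s : Set E} {σ : ℝ} {h : E → ℝ}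
    (hs : StrongConvexOn s σ h) {x y : E} (hx : x ∈ s) (hy : y ∈ s)
    (hdx : DifferentiableAt ℝ h x) (hdy : DifferentiableAt ℝ h y) :
    σ * ‖x - y‖ ^ 2 ≤ inner ℝ (gradient h x - gradient h y) (x - y) := by
  -- Divide the strong convexity inequality along the segment by `t` and let `t ↓ 0`; the two orders
  -- of `x`, `y` are then added.
  have key : ∀ u ∈ s, ∀ v ∈ s, DifferentiableAt ℝ h v →
      inner ℝ (gradient h v) (u - v) ≤ h u - h v - σ / 2 * ‖u - v‖ ^ 2 := by
    intro u hu v hv hd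
    have hder : HasDerivAt (fun t : ℝ => h (v + t • (u - v)))
        (inner ℝ (gradient h v) (u - v)) 0 := by
      have h1 : HasFDerivAt h (InnerProductSpace.toDual ℝ E (gradient h v))
          (v + (0 : ℝ) • (u - v)) := by
        simpa using hd.hasGradientAt.hasFDerivAt
      have h2 : HasDerivAt (fun t : ℝ => v + t • (u - v)) (u - v) 0 := by
        simpa using ((hasDerivAt_id (0 : ℝ)).smul_const (u - v)).const_add v
      have h3 := h1.comp_hasDerivAt (0 : ℝ) h2
      rwa [InnerProductSpace.toDual_apply_apply] at h3
    have hlim := (hasDerivAt_iff_tendsto_slope_zero.1 hder).mono_left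
      (nhdsWithin_mono (0 : ℝ) (t := {0}ᶜ) (s := Set.Ioi 0) fun t ht => ne_of_gt ht)
    have hR : Tendsto (fun t : ℝ => h u - h v - (1 - t) * (σ / 2 * ‖u - v‖ ^ 2)) (𝓝[>] 0)
        (𝓝 (h u - h v - (1 - 0) * (σ / 2 * ‖u - v‖ ^ 2))) := by
      refine Tendsto.mono_left (Continuous.tendsto ?_ 0) nhdsWithin_le_nhds
      fun_prop
    rw [sub_zero, one_mul] at hR
    refine le_of_tendsto_of_tendsto hlim hR ?_
    have h1 : ∀ᶠ t : ℝ in 𝓝[>] 0, t < 1 := nhdsWithin_le_nhds (gt_mem_nhds one_pos)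
    filter_upwards [h1, self_mem_nhdsWithin] with t ht ht0
    have ht0 : (0 : ℝ) < t := ht0
    have := hs.2 hu hv ht0.le (sub_nonneg.2 ht.le) (by ring)
    have he : t • u + (1 - t) • v = v + (0 + t) • (u - v) := by module
    rw [he] at this
    simp only [smul_eq_mul, zero_smul, add_zero] at this ⊢
    rw [inv_mul_le_iff₀ ht0]
    linarith
  have h1 := key x hx y hy hdy
  have h2 := key y hy x hx hdx
  rw [← neg_sub x y, inner_neg_right, norm_neg] at h2
  rw [inner_sub_left]
  linarith

/-! ### Block sets and their normal cones -/

section Block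

variable {α β : Type*} [Fintype α] [DecidableEq β]

/-- Nonnegative vectors with prescribed sums over the fibres of `b`. -/
def blockSet (b : α → β) (μ : β → ℝ) : Set (EuclideanSpace ℝ α) :=
  {x | (∀ a, 0 ≤ x a) ∧ ∀ i, ∑ a with b a = i, x a = μ i}

lemma convex_blockSet (b : α → β) (μ : β → ℝ) : Convex ℝ (blockSet b μ) := by
  intro x hx y hy s t hs ht hst
  refine ⟨fun a => ?_, fun i => ?_⟩
  · have := hx.1 a
    have := hy.1 a
    simp only [PiLp.add_apply, PiLp.smul_apply, smul_eq_mul]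
    positivity
  · simp only [PiLp.add_apply, PiLp.smul_apply, smul_eq_mul, Finset.sum_add_distrib,
      ← Finset.mul_sum, hx.2, hy.2, ← add_mul, hst, one_mul]

lemma isClosed_blockSet (b : α → β) (μ : β → ℝ) : IsClosed (blockSet b μ) := by
  simp only [blockSet, Set.ofPred_and, Set.ofPred_forall]
  exact (isClosed_iInter fun a => isClosed_le continuous_const (by fun_prop)).inter
    (isClosed_iInter fun i => isClosed_eq (by fun_prop) continuous_const)

lemma norm_le_one_of_mem_blockSet [Fintype β] {b : α → β} {μ : β → ℝ} (hμ : ∑ i, μ i = 1)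
    {x : EuclideanSpace ℝ α} (hx : x ∈ blockSet b μ) : ‖x‖ ≤ 1 := by
  have h1 : ∑ a, x a = 1 := by
    rw [← Finset.sum_fiberwise Finset.univ b, ← hμ]
    exact Finset.sum_congr rfl fun i _ => hx.2 i
  rw [← sq_le_one_iff₀ (norm_nonneg x), EuclideanSpace.real_norm_sq_eq, ← h1]
  refine Finset.sum_le_sum fun a _ => ?_
  have h2 : x a ≤ 1 := h1 ▸ Finset.single_le_sum (fun a _ => hx.1 a) (Finset.mem_univ a)
  nlinarith [hx.1 a]

lemma isCompact_blockSet [Fintype β] {b : α → β} {μ : β → ℝ} (hμ : ∑ i, μ i = 1) :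
    IsCompact (blockSet b μ) :=
  (isCompact_closedBall 0 1).of_isClosed_subset (isClosed_blockSet b μ) fun _ hx =>
    mem_closedBall_zero_iff.2 (norm_le_one_of_mem_blockSet hμ hx)

/-- Moving all the mass at `a` to `a'` stays in the set; the normal inequality in that direction is
the claim. -/
lemma le_of_mem_normalCone_blockSet {b : α → β} {μ : β → ℝ} {x p : EuclideanSpace ℝ α}
    (hp : p ∈ normalCone (blockSet b μ) x) {a a' : α} (hb : b a = b a') (ha : x a ≠ 0) :
    p a' ≤ p a := by
  classical
  have hpos : 0 < x a := lt_of_le_of_ne (hp.1.1 a) ha.symm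
  by_cases haa : a' = a
  · rw [haa]
  set d : EuclideanSpace ℝ α := EuclideanSpace.single a' (x a) - EuclideanSpace.single a (x a)
    with hd
  have hy : x + d ∈ blockSet b μ := by
    refine ⟨fun k => ?_, fun i => ?_⟩
    · have := hp.1.1 k
      simp only [hd, PiLp.add_apply, PiLp.sub_apply, PiLp.single_apply]
      split_ifs <;> subst_vars <;> linarith
    · simp only [hd, PiLp.add_apply, PiLp.sub_apply, PiLp.single_apply,
        Finset.sum_add_distrib, Finset.sum_sub_distrib, hp.1.2]
      simp [Finset.sum_ite_eq', hb]
  have h := hp.2 _ hy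
  rw [add_sub_cancel_left, hd, inner_sub_right, EuclideanSpace.inner_single_right,
    EuclideanSpace.inner_single_right] at h
  simp only [conj_trivial, ← mul_sub] at h
  have := nonpos_of_mul_nonpos_right h hpos
  linarith

/-- In each block `p` is maximal on the support of `x`, so replacing `p` by its block maximum only
increases the pairing with `y - x`, and the result vanishes because block sums agree. With the
converse above, this turns normality into finitely many linear inequalities once the support is
fixed. -/
lemma mem_normalCone_blockSet [Fintype β] {b : α → β} {μ : β → ℝ} {x p : EuclideanSpace ℝ α}
    (hx : x ∈ blockSet b μ) (hp : ∀ a a', b a = b a' → x a ≠ 0 → p a' ≤ p a) :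
    p ∈ normalCone (blockSet b μ) x := by
  refine ⟨hx, fun y hy => ?_⟩
  have hin : inner ℝ p (y - x) = ∑ i, ∑ a with b a = i, p a * (y a - x a) := by
    rw [Finset.sum_fiberwise]
    simp [PiLp.inner_apply, mul_comm]
  rw [hin]
  refine Finset.sum_nonpos fun i _ => ?_
  rcases (Finset.univ.filter fun a => b a = i).eq_empty_or_nonempty with h0 | hne
  · simp [h0]
  obtain ⟨m, hm, hmax⟩ := Finset.exists_max_image _ (fun a => p a) hne
  have hle : ∀ a ∈ Finset.univ.filter (fun a => b a = i),
      p a * (y a - x a) ≤ p m * (y a - x a) := by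
    intro a ha
    have h1 := hmax a ha
    have h2 := hy.1 a
    by_cases hxa : x a = 0
    · rw [hxa, sub_zero]; exact mul_le_mul_of_nonneg_right h1 h2
    · have h3 := hp a m ((Finset.mem_filter.1 ha).2.trans (Finset.mem_filter.1 hm).2.symm) hxa
      rw [le_antisymm h1 h3]
  refine (Finset.sum_le_sum hle).trans ?_
  rw [← Finset.mul_sum, Finset.sum_sub_distrib, hy.2, hx.2]
  simp

lemma abs_block_sum_le (b : α → β) (i : β) (x : EuclideanSpace ℝ α) :
    |∑ a with b a = i, x a| ≤ Fintype.card α * ‖x‖ := by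
  refine (Finset.abs_sum_le_sum_abs _ _).trans ?_
  calc ∑ a with b a = i, |x a| ≤ ∑ a, |x a| :=
        Finset.sum_le_sum_of_subset_of_nonneg (Finset.filter_subset _ _) fun _ _ _ => abs_nonneg _
    _ ≤ ∑ _a : α, ‖x‖ := Finset.sum_le_sum fun a _ => PiLp.norm_apply_le x a
    _ = _ := by simp

end Block

/-! ### Linear regularity, nearby critical points and existence -/

section Critical

variable {α β γ : Type*} [Fintype α] [Fintype β] [Fintype γ] [DecidableEq β] [DecidableEq γ]

/-- Points of both block sets at which `-G x` splits into a sum of normals. -/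
def splitCriticalSet (b : α → β) (c : α → γ) (μ : β → ℝ) (ν : γ → ℝ)
    (G : EuclideanSpace ℝ α →L[ℝ] EuclideanSpace ℝ α) : Set (EuclideanSpace ℝ α) :=
  {x | ∃ p ∈ normalCone (blockSet b μ) x, ∃ q ∈ normalCone (blockSet c ν) x, G x + p + q = 0}

/-- The sum over a fibre of `b`, as a linear functional. -/
def blockSum (b : α → β) (i : β) : EuclideanSpace ℝ α →ₗ[ℝ] ℝ where
  toFun x := ∑ a with b a = i, x a
  map_add' x y := by simp [Finset.sum_add_distrib]
  map_smul' t x := by simp [Finset.mul_sum]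

/-- The evaluation at a coordinate, as a linear functional. -/
def coord (a : α) : EuclideanSpace ℝ α →ₗ[ℝ] ℝ where
  toFun x := x a
  map_add' x y := by simp
  map_smul' t x := by simp

/-- The two block sets are linearly regular. -/
lemma exists_mem_inter_norm_sub_le (b : α → β) (c : α → γ) (μ : β → ℝ) (ν : γ → ℝ)
    (hne : (blockSet b μ ∩ blockSet c ν).Nonempty) :
    ∃ κ : ℝ, 0 ≤ κ ∧ ∀ x ∈ blockSet b μ, ∀ y ∈ blockSet c ν,
      ∃ z ∈ blockSet b μ ∩ blockSet c ν, ‖x - z‖ ≤ κ * ‖x - y‖ := by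
  obtain ⟨κ, hκ0, hκ⟩ := hoffman_bound (E := EuclideanSpace ℝ α)
    (ι := α ⊕ (β ⊕ β) ⊕ (γ ⊕ γ)) fun k => LinearMap.toContinuousLinearMap <|
      Sum.elim (fun a => -coord a) (Sum.elim
        (Sum.elim (fun i => blockSum b i) fun i => -blockSum b i)
        (Sum.elim (fun j => blockSum c j) fun j => -blockSum c j)) k
  refine ⟨κ * Fintype.card α, by positivity, fun x hx y hy => ?_⟩
  have h0 : 0 ≤ Fintype.card α * ‖x - y‖ := by positivity
  have hj : ∀ j, |∑ a with c a = j, x a - ν j| ≤ Fintype.card α * ‖x - y‖ := by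
    intro j
    have := abs_block_sum_le c j (x - y)
    simpa only [PiLp.sub_apply, Finset.sum_sub_distrib, hy.2] using this
  obtain ⟨z, hz, hzn⟩ := hκ
    (Sum.elim (fun _ => 0) (Sum.elim (Sum.elim μ (-μ)) (Sum.elim ν (-ν))))
    (by
      obtain ⟨z, hzB, hzC⟩ := hne
      refine ⟨z, ?_⟩
      rintro (a | (i | i) | (j | j))
      · exact neg_nonpos.2 (hzB.1 a)
      · exact (hzB.2 i).le
      · exact neg_le_neg (hzB.2 i).ge
      · exact (hzC.2 j).le
      · exact neg_le_neg (hzC.2 j).ge)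
    x (Fintype.card α * ‖x - y‖) h0 (by
      rintro (a | (i | i) | (j | j))
      · change -x a ≤ 0 + _
        linarith [hx.1 a]
      · change ∑ a with b a = i, x a ≤ μ i + _
        linarith [hx.2 i]
      · change -∑ a with b a = i, x a ≤ -μ i + _
        linarith [hx.2 i]
      · change ∑ a with c a = j, x a ≤ ν j + _
        linarith [(abs_le.1 (hj j)).2]
      · change -∑ a with c a = j, x a ≤ -ν j + _
        linarith [(abs_le.1 (hj j)).1])
  have hpos : ∀ a, 0 ≤ z a := fun a => neg_nonpos.1 (hz (.inl a))
  refine ⟨z, ⟨⟨hpos, fun i => le_antisymm (hz (.inr (.inl (.inl i)))) ?_⟩,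
    hpos, fun j => le_antisymm (hz (.inr (.inr (.inl j)))) ?_⟩, by rwa [mul_assoc]⟩
  · exact neg_le_neg_iff.1 (hz (.inr (.inl (.inr i))))
  · exact neg_le_neg_iff.1 (hz (.inr (.inr (.inr j))))

/-- Exact solutions near approximately critical pairs with zero patterns `I` and `J`. -/
lemma exists_critical_near_of_pattern (b : α → β) (c : α → γ) (μ : β → ℝ) (ν : γ → ℝ)
    (G : EuclideanSpace ℝ α →L[ℝ] EuclideanSpace ℝ α) (I J : Set α) :
    ∀ᶠ C : ℝ in atTop, ∀ x y p q : EuclideanSpace ℝ α,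
      (∀ a, x a = 0 ↔ a ∈ I) → (∀ a, y a = 0 ↔ a ∈ J) →
      p ∈ normalCone (blockSet b μ) x → q ∈ normalCone (blockSet c ν) y →
      G ((1 / 2 : ℝ) • (x + y)) + p + q = 0 → C * ‖x - y‖ < 1 →
      ∃ z ∈ splitCriticalSet b c μ ν G, ‖(1 / 2 : ℝ) • (x + y) - z‖ ≤ C * ‖x - y‖ := by
  classical
  let X := LinearMap.fst ℝ (EuclideanSpace ℝ α) (EuclideanSpace ℝ α)
  let P := LinearMap.snd ℝ (EuclideanSpace ℝ α) (EuclideanSpace ℝ α)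
  -- Eliminating `q` makes the criticality equation automatic; the unknowns are the point and `p`.
  let Q := -(G.toLinearMap ∘ₗ X) - P
  have hsys := approx_solution_bound (E := EuclideanSpace ℝ α × EuclideanSpace ℝ α)
    (ι := α ⊕ (β ⊕ β) ⊕ (γ ⊕ γ) ⊕ α ⊕ (α × α) ⊕ (α × α))
    (Sum.elim (fun a => -(coord a ∘ₗ X)) <| Sum.elim
      (Sum.elim (fun i => blockSum b i ∘ₗ X) fun i => -(blockSum b i ∘ₗ X)) <| Sum.elim
      (Sum.elim (fun j => blockSum c j ∘ₗ X) fun j => -(blockSum c j ∘ₗ X)) <| Sum.elim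
      -- Vanishing on `I ∪ J` confines the support of a solution to those of both `x` and `y`, where
      -- the inequalities on `p` and `q` are imposed.
      (fun a => if a ∈ I ∪ J then coord a ∘ₗ X else 0) <| Sum.elim
      (fun k => if b k.1 = b k.2 ∧ k.1 ∉ I then coord k.2 ∘ₗ P - coord k.1 ∘ₗ P else 0)
      (fun k => if c k.1 = c k.2 ∧ k.1 ∉ J then coord k.2 ∘ₗ Q - coord k.1 ∘ₗ Q else 0))
    (Sum.elim (fun _ => 0) <| Sum.elim (Sum.elim μ (-μ)) <| Sum.elim (Sum.elim ν (-ν)) <|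
      Sum.elim (fun _ => 0) <| Sum.elim (fun _ => 0) (fun _ => 0))
  have hN : (0 : ℝ) < Fintype.card α + 1 := by positivity
  filter_upwards [(tendsto_id.atTop_div_const hN).eventually hsys] with C hC x y p q hI hJ hp hq
    hG hlt
  have hCr : C / (Fintype.card α + 1) * ((Fintype.card α + 1) * ‖x - y‖) = C * ‖x - y‖ := by
    field_simp
  have h := hC ((1 / 2 : ℝ) • (x + y), p) ((Fintype.card α + 1) * ‖x - y‖) (by positivity)
    (by rw [id, hCr]; exact hlt)
  rw [id, hCr] at h
  have hr0 : 0 ≤ (Fintype.card α + 1) * ‖x - y‖ := by positivity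
  have hcard : 0 ≤ Fintype.card α * ‖x - y‖ := by positivity
  have hcoord : ∀ a, |x a - y a| ≤ ‖x - y‖ := fun a => PiLp.norm_apply_le (x - y) a
  have hQ : Q ((1 / 2 : ℝ) • (x + y), p) = q := by
    have : q = -G ((1 / 2 : ℝ) • (x + y)) - p := by
      rw [eq_comm, ← sub_eq_zero, ← neg_eq_zero, ← hG]; abel
    rw [this]; rfl
  have hbsum : ∀ i, blockSum b i ((1 / 2 : ℝ) • (x + y)) =
      μ i - 1 / 2 * ∑ a with b a = i, (x - y) a := by
    intro i
    have hx : blockSum b i x = μ i := hp.1.2 i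
    have hd : ∑ a with b a = i, (x - y) a = blockSum b i (x - y) := rfl
    rw [hd, map_smul, map_add, map_sub, hx, smul_eq_mul]
    ring
  have hcsum : ∀ j, blockSum c j ((1 / 2 : ℝ) • (x + y)) =
      ν j + 1 / 2 * ∑ a with c a = j, (x - y) a := by
    intro j
    have hy : blockSum c j y = ν j := hq.1.2 j
    have hd : ∑ a with c a = j, (x - y) a = blockSum c j (x - y) := rfl
    rw [hd, map_smul, map_add, map_sub, hy, smul_eq_mul]
    ring
  have hbdiff := fun i => abs_block_sum_le b i (x - y)
  have hcdiff := fun j => abs_block_sum_le c j (x - y)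
  have hn := norm_nonneg (x - y)
  obtain ⟨⟨z, p'⟩, hz, hzn⟩ := h (by
    simp only [Sum.forall, Sum.elim_inl, Sum.elim_inr]
    refine ⟨fun a => ?_, ⟨fun i => ?_, fun i => ?_⟩, ⟨fun j => ?_, fun j => ?_⟩, fun a => ?_,
      fun k => ?_, fun k => ?_⟩
    · change -((1 / 2 : ℝ) * (x a + y a)) ≤ 0 + _
      linarith [hp.1.1 a, hq.1.1 a]
    · change blockSum b i ((1 / 2 : ℝ) • (x + y)) ≤ μ i + _
      rw [hbsum]
      linarith [(abs_le.1 (hbdiff i)).1]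
    · change -blockSum b i ((1 / 2 : ℝ) • (x + y)) ≤ -μ i + _
      rw [hbsum]
      linarith [(abs_le.1 (hbdiff i)).2]
    · change blockSum c j ((1 / 2 : ℝ) • (x + y)) ≤ ν j + _
      rw [hcsum]
      linarith [(abs_le.1 (hcdiff j)).2]
    · change -blockSum c j ((1 / 2 : ℝ) • (x + y)) ≤ -ν j + _
      rw [hcsum]
      linarith [(abs_le.1 (hcdiff j)).1]
    · split_ifs with ha
      · change (1 / 2 : ℝ) * (x a + y a) ≤ 0 + _
        have h1 := abs_le.1 (hcoord a)
        rcases ha with ha | ha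
        · rw [← hI] at ha
          linarith
        · rw [← hJ] at ha
          linarith
      · simpa using hr0
    · split_ifs with hk
      · change p k.2 - p k.1 ≤ 0 + _
        linarith [le_of_mem_normalCone_blockSet hp hk.1 fun h => hk.2 ((hI _).1 h)]
      · simpa using hr0
    · split_ifs with hk
      · rw [LinearMap.sub_apply, LinearMap.comp_apply, LinearMap.comp_apply, hQ]
        change q k.2 - q k.1 ≤ 0 + _
        linarith [le_of_mem_normalCone_blockSet hq hk.1 fun h => hk.2 ((hJ _).1 h)]
      · simpa using hr0)
  simp only [Sum.forall, Sum.elim_inl, Sum.elim_inr] at hz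
  obtain ⟨hz0, ⟨hzb, hzb'⟩, ⟨hzc, hzc'⟩, hzI, hzp, hzq⟩ := hz
  have hpos : ∀ a, 0 ≤ z a := fun a => neg_nonpos.1 (hz0 a)
  have hzero : ∀ a ∈ I ∪ J, z a = 0 := fun a ha => by
    have := hzI a
    rw [if_pos ha] at this
    exact le_antisymm this (hpos a)
  have hzB : z ∈ blockSet b μ :=
    ⟨hpos, fun i => le_antisymm (hzb i) (neg_le_neg_iff.1 (hzb' i))⟩
  have hzC : z ∈ blockSet c ν :=
    ⟨hpos, fun j => le_antisymm (hzc j) (neg_le_neg_iff.1 (hzc' j))⟩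
  refine ⟨z, ⟨p', mem_normalCone_blockSet hzB fun a a' hb ha => ?_, Q (z, p'),
    mem_normalCone_blockSet hzC fun a a' hb ha => ?_, ?_⟩, ?_⟩
  · have := hzp (a, a')
    rw [if_pos ⟨hb, fun h => ha (hzero a (Or.inl h))⟩] at this
    exact sub_nonpos.1 this
  · have := hzq (a, a')
    rw [if_pos ⟨hb, fun h => ha (hzero a (Or.inr h))⟩] at this
    exact sub_nonpos.1 this
  · change G z + p' + (-G z - p') = 0
    abel
  · exact (norm_fst_le _).trans hzn

/-- Critical points near approximately critical pairs. -/
lemma exists_critical_near (b : α → β) (c : α → γ) (μ : β → ℝ) (ν : γ → ℝ)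
    (G : EuclideanSpace ℝ α →L[ℝ] EuclideanSpace ℝ α) :
    ∀ᶠ C : ℝ in atTop, ∀ x y p q : EuclideanSpace ℝ α,
      p ∈ normalCone (blockSet b μ) x → q ∈ normalCone (blockSet c ν) y →
      G x + G y + p + q = 0 → C * ‖x - y‖ < 1 →
      ∃ z ∈ splitCriticalSet b c μ ν G, ‖(1 / 2 : ℝ) • (x + y) - z‖ ≤ C * ‖x - y‖ := by
  have h := eventually_all.2 fun I : Set α => eventually_all.2 fun J : Set α =>
    exists_critical_near_of_pattern b c μ ν G I J
  filter_upwards [h] with C hC x y p q hp hq hG hlt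
  refine hC {a | x a = 0} {a | y a = 0} x y ((1 / 2 : ℝ) • p) ((1 / 2 : ℝ) • q)
    (fun _ => Iff.rfl) (fun _ => Iff.rfl) (smul_mem_normalCone hp (by norm_num))
    (smul_mem_normalCone hq (by norm_num)) ?_ hlt
  rw [map_smul, map_add, ← smul_add, ← smul_add, hG, smul_zero]

/-- Minimise `f x + f y + k‖x - y‖²` over the product of the block sets. The penalty gradients
cancel in the sum of the two optimality conditions, and a large `k` makes the gap small enough for
`exists_critical_near`; no sum rule for normal cones is required. -/
lemma splitCriticalSet_nonempty (b : α → β) (c : α → γ) (μ : β → ℝ) (ν : γ → ℝ)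
    (hμ : ∑ i, μ i = 1) (hν : ∑ j, ν j = 1)
    (hne : (blockSet b μ ∩ blockSet c ν).Nonempty)
    {f : EuclideanSpace ℝ α → ℝ} {G : EuclideanSpace ℝ α →L[ℝ] EuclideanSpace ℝ α}
    (hf : ∀ x, HasGradientAt f (G x) x) : (splitCriticalSet b c μ ν G).Nonempty := by
  have hfc : Continuous f := continuous_iff_continuousAt.2 fun x => (hf x).continuousAt
  obtain ⟨z, hzB, hzC⟩ := hne
  obtain ⟨M, hM⟩ := (isCompact_closedBall (0 : EuclideanSpace ℝ α) 1).exists_bound_of_continuousOn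
    hfc.continuousOn
  obtain ⟨C, hC, hC0⟩ := ((exists_critical_near b c μ ν G).and (eventually_gt_atTop 0)).exists
  have hM0 : 0 ≤ M := (norm_nonneg _).trans (hM 0 (by simp))
  -- Comparison with `(z, z)` gives `k‖x - y‖² ≤ 4M`, so this `k` forces `C‖x - y‖ < 1`.
  set k : ℝ := C ^ 2 * (4 * M + 1) with hk
  have hk0 : 0 < k := by positivity
  have hcont : Continuous fun u : EuclideanSpace ℝ α × EuclideanSpace ℝ α =>
      f u.1 + f u.2 + k * ‖u.1 - u.2‖ ^ 2 := by fun_prop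
  obtain ⟨⟨x, y⟩, ⟨hx, hy⟩, hmin⟩ := ((isCompact_blockSet (b := b) hμ).prod
    (isCompact_blockSet (b := c) hν)).exists_isMinOn ⟨(z, z), hzB, hzC⟩ hcont.continuousOn
  have hb : ∀ {v}, ‖v‖ ≤ 1 → |f v| ≤ M := fun hv => hM _ (mem_closedBall_zero_iff.2 hv)
  have hxM := abs_le.1 (hb (norm_le_one_of_mem_blockSet hμ hx))
  have hyM := abs_le.1 (hb (norm_le_one_of_mem_blockSet hν hy))
  have hzM := abs_le.1 (hb (norm_le_one_of_mem_blockSet hμ hzB))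
  have hle := hmin (show (z, z) ∈ blockSet b μ ×ˢ blockSet c ν from ⟨hzB, hzC⟩)
  have hsq : ∀ u v : EuclideanSpace ℝ α,
      HasGradientAt (fun u => k * ‖u - v‖ ^ 2) ((2 * k) • (u - v)) u := by
    intro u v
    have h1 := (((hasFDerivAt_id u).sub_const v).norm_sq).const_mul k
    rw [hasGradientAt_iff_hasFDerivAt]
    refine HasFDerivAt.congr_fderiv h1 ?_
    ext d
    simp
    ring
  have hadd : ∀ u v : EuclideanSpace ℝ α,
      HasGradientAt (fun u => f u + k * ‖u - v‖ ^ 2) (G u + (2 * k) • (u - v)) u := by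
    intro u v
    rw [hasGradientAt_iff_hasFDerivAt, map_add]
    exact (hf u).hasFDerivAt.add (hsq u v).hasFDerivAt
  have hp := neg_gradient_mem_normalCone (convex_blockSet b μ) hx
    (φ := fun u => f u + k * ‖u - y‖ ^ 2) (fun u hu => by
      have := hmin (show (u, y) ∈ blockSet b μ ×ˢ blockSet c ν from ⟨hu, hy⟩)
      simp only [Set.mem_ofPred_eq] at this ⊢
      linarith) (hadd x y)
  have hq := neg_gradient_mem_normalCone (convex_blockSet c ν) hy
    (φ := fun u => f u + k * ‖u - x‖ ^ 2) (fun u hu => by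
      have := hmin (show (x, u) ∈ blockSet b μ ×ˢ blockSet c ν from ⟨hx, hu⟩)
      simp only [Set.mem_ofPred_eq, norm_sub_rev x] at this ⊢
      linarith) (hadd y x)
  obtain ⟨w, hw, -⟩ := hC x y _ _ hp hq (by module) (by
    simp only [Set.mem_ofPred_eq, sub_self, norm_zero] at hle
    have h1 : k * ‖x - y‖ ^ 2 ≤ 4 * M := by linarith
    have h2 : (C * ‖x - y‖) ^ 2 < 1 := by
      by_contra! h3
      have : (4 * M + 1) * 1 ≤ (4 * M + 1) * (C * ‖x - y‖) ^ 2 := by gcongr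
      rw [hk] at h1
      linarith
    exact (sq_lt_one_iff₀ (by positivity)).1 h2)
  exact ⟨w, hw⟩

end Critical

/-! ### Specialisation to couplings -/

lemma rowSet_eq_blockSet {n m : ℕ} (μ : Fin n → ℝ) :
    rowSet m μ = blockSet (α := Fin n × Fin m) Prod.fst μ := by
  have h : ∀ (x : Coupling n m) i,
      ∑ a : Fin n × Fin m with a.1 = i, x a = ∑ j, x (i, j) := by
    intro x i
    rw [Finset.sum_filter, Fintype.sum_prod_type]
    simp [Finset.sum_ite_irrel]
  ext x
  simp only [rowSet, blockSet, Set.mem_ofPred_eq, h, Prod.forall]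

lemma colSet_eq_blockSet {n m : ℕ} (ν : Fin m → ℝ) :
    colSet n ν = blockSet (α := Fin n × Fin m) Prod.snd ν := by
  have h : ∀ (x : Coupling n m) j,
      ∑ a : Fin n × Fin m with a.2 = j, x a = ∑ i, x (i, j) := by
    intro x j
    rw [Finset.sum_filter, Fintype.sum_prod_type]
    simp
  ext x
  simp only [colSet, blockSet, Set.mem_ofPred_eq, h, Prod.forall]

lemma rowSet_inter_colSet_nonempty {n m : ℕ} {μ : Fin n → ℝ} {ν : Fin m → ℝ}
    (hμ : ∀ i, 0 ≤ μ i) (hν : ∀ j, 0 ≤ ν j) (hμ1 : ∑ i, μ i = 1) (hν1 : ∑ j, ν j = 1) :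
    (rowSet m μ ∩ colSet n ν).Nonempty := by
  refine ⟨WithLp.toLp 2 fun a => μ a.1 * ν a.2, ⟨fun i j => mul_nonneg (hμ i) (hν j), fun i => ?_⟩,
    fun i j => mul_nonneg (hμ i) (hν j), fun j => ?_⟩
  · simp [← Finset.mul_sum, hν1]
  · simp [← Finset.sum_mul, hμ1]

/-- The objective is a quadratic form, so its gradient is linear. -/
lemma exists_hasGradientAt_objective {n m : ℕ} (DX : Matrix (Fin n) (Fin n) ℝ)
    (DY : Matrix (Fin m) (Fin m) ℝ) :
    ∃ G : Coupling n m →L[ℝ] Coupling n m, ∀ x, HasGradientAt (objective DX DY) (G x) x := by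
  have hadd : ∀ x y : Coupling n m, toMat (x + y) = toMat x + toMat y := fun _ _ => rfl
  have hsmul : ∀ (t : ℝ) (x : Coupling n m), toMat (t • x) = t • toMat x := fun _ _ => rfl
  let A : Coupling n m →L[ℝ] Coupling n m := LinearMap.toContinuousLinearMap
    { toFun := fun x => WithLp.toLp 2 fun a => -(DX * toMat x * DY) a.1 a.2
      map_add' := fun x y => by
        ext a
        simp [hadd, Matrix.mul_add, Matrix.add_mul]
        ring
      map_smul' := fun t x => by
        ext a
        simp [hsmul] }
  have hA : objective DX DY = fun x => inner ℝ (A x) x := by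
    funext x
    simp [objective, A, PiLp.inner_apply, Fintype.sum_prod_type, Matrix.trace, toMat,
      Matrix.mul_apply (N := Matrix.transpose _), mul_comm]
  refine ⟨A + ContinuousLinearMap.adjoint A, fun x => ?_⟩
  rw [hA, hasGradientAt_iff_hasFDerivAt]
  refine HasFDerivAt.congr_fderiv (A.hasFDerivAt.inner ℝ (hasFDerivAt_id x)) ?_
  ext d
  simp [ContinuousLinearMap.adjoint_inner_left, real_inner_comm]

end GW

theorem mainTheorem2 {n m : ℕ}
    (DX : Matrix (Fin n) (Fin n) ℝ) (DY : Matrix (Fin m) (Fin m) ℝ)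
    (hDX : DX.IsSymm) (hDY : DY.IsSymm)
    (μ : Fin n → ℝ) (ν : Fin m → ℝ)
    (hμ : ∀ i, 0 ≤ μ i) (hν : ∀ j, 0 ≤ ν j)
    (hμ1 : ∑ i, μ i = 1) (hν1 : ∑ j, ν j = 1)
    (σ : ℝ) (hσ : 0 < σ) :
    (GW.criticalSet DX DY μ ν).Nonempty ∧
    ∃ τ₁ τ₂ : ℝ, ∀ (D : Set (GW.Coupling n m)) (h : GW.Coupling n m → ℝ),
      IsOpen D → Convex ℝ D → DifferentiableOn ℝ h D →
      StrongConvexOn (D ∩ convexHull ℝ (GW.rowSet m μ ∪ GW.colSet n ν)) σ h →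
      ∀ ρ : ℝ, 0 < ρ → ∀ π w : GW.Coupling n m, π ∈ D → w ∈ D →
        (π, w) ∈ GW.fixedPointSet DX DY μ ν h ρ →
        ‖π - w‖ ≤ τ₁ / ρ ∧
        Metric.infDist ((1 / 2 : ℝ) • (π + w)) (GW.criticalSet DX DY μ ν) ≤ τ₂ / ρ := by
  obtain ⟨G, hG⟩ := GW.exists_hasGradientAt_objective DX DY
  have hgrad : ∀ x, gradient (GW.objective DX DY) x = G x := fun x => (hG x).gradient
  have hne := GW.rowSet_inter_colSet_nonempty hμ hν hμ1 hν1
  have hcrit : GW.criticalSet DX DY μ ν =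
      GW.splitCriticalSet (α := Fin n × Fin m) Prod.fst Prod.snd μ ν G := by
    ext x
    simp only [GW.criticalSet, GW.splitCriticalSet, hgrad, GW.rowSet_eq_blockSet,
      GW.colSet_eq_blockSet, Set.mem_ofPred_eq]
    exact ⟨fun h => h.2, fun ⟨p, hp, q, hq, h⟩ => ⟨⟨hp.1, hq.1⟩, p, hp, q, hq, h⟩⟩
  simp only [GW.fixedPointSet, hgrad, Set.mem_ofPred_eq]
  rw [hcrit]
  rw [GW.rowSet_eq_blockSet, GW.colSet_eq_blockSet] at *
  have hXne := GW.splitCriticalSet_nonempty (α := Fin n × Fin m) Prod.fst Prod.snd μ ν hμ1 hν1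
    hne hG
  refine ⟨hXne, ?_⟩
  obtain ⟨κ, hκ0, hκ⟩ := GW.exists_mem_inter_norm_sub_le (α := Fin n × Fin m)
    Prod.fst Prod.snd μ ν hne
  obtain ⟨C, hC, hC0⟩ := ((GW.exists_critical_near (α := Fin n × Fin m)
    Prod.fst Prod.snd μ ν G).and (eventually_gt_atTop 0)).exists
  obtain ⟨e, he⟩ := hXne
  -- In units of `‖π - w‖`, `2κ + 1` adds `κ` for `‖z - π‖` and `κ + 1` for `‖z - w‖`. The factor
  -- `3` leaves room for the case `C‖π - w‖ ≥ 1`.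
  refine ⟨‖G‖ * (2 * κ + 1) / σ, 3 * C * (‖G‖ * (2 * κ + 1) / σ), ?_⟩
  intro D h hD _ hdiff hconv ρ hρ π w hπ hw ⟨p, hp, q, hq, h1, h2⟩
  have hπ1 := GW.norm_le_one_of_mem_blockSet hμ1 hp.1
  have hw1 := GW.norm_le_one_of_mem_blockSet hν1 hq.1
  have hbound : ‖π - w‖ ≤ ‖G‖ * (2 * κ + 1) / σ / ρ := by
    obtain ⟨z, ⟨hzB, hzC⟩, hz⟩ := hκ π hp.1 w hq.1
    have hmono := GW.strongConvexOn_gradient_monotone hconv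
      ⟨hπ, subset_convexHull ℝ _ (Or.inl hp.1)⟩ ⟨hw, subset_convexHull ℝ _ (Or.inr hq.1)⟩
      (hdiff.differentiableAt (hD.mem_nhds hπ)) (hdiff.differentiableAt (hD.mem_nhds hw))
    have hpz := hp.2 z hzB
    have hqz := hq.2 z hzC
    rw [show p = -(G w + ρ • (gradient h π - gradient h w)) from
      (neg_eq_of_add_eq_zero_right h1).symm] at hpz
    rw [show q = -(G π - ρ • (gradient h π - gradient h w)) by
      rw [eq_comm, neg_eq_iff_add_eq_zero, ← h2]; module] at hqz
    have hsplit : inner ℝ (gradient h π - gradient h w) (π - w) =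
        inner ℝ (gradient h π - gradient h w) (z - w) -
          inner ℝ (gradient h π - gradient h w) (z - π) := by
      rw [← inner_sub_right]; congr 1; abel
    simp only [inner_neg_left, inner_add_left, inner_sub_left (G π), real_inner_smul_left]
      at hpz hqz
    have hkey : ρ * (σ * ‖π - w‖ ^ 2) ≤ inner ℝ (G w) (z - π) + inner ℝ (G π) (z - w) := by
      have := mul_le_mul_of_nonneg_left hmono hρ.le
      rw [hsplit] at this
      linarith
    have hip : ∀ u v : GW.Coupling n m, ‖u‖ ≤ 1 → inner ℝ (G u) v ≤ ‖G‖ * ‖v‖ := by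
      intro u v hu
      refine (real_inner_le_norm _ _).trans (mul_le_mul_of_nonneg_right ?_ (norm_nonneg _))
      exact (G.le_opNorm u).trans (mul_le_of_le_one_right (norm_nonneg _) hu)
    have hzw : ‖z - w‖ ≤ κ * ‖π - w‖ + ‖π - w‖ := by
      have := norm_sub_le_norm_sub_add_norm_sub z π w
      rw [norm_sub_rev z π] at this
      linarith
    rw [norm_sub_rev] at hz
    have hfin : ρ * (σ * ‖π - w‖ ^ 2) ≤ ‖G‖ * (2 * κ + 1) * ‖π - w‖ := by
      have e1 := hip w (z - π) hw1
      have e2 := hip π (z - w) hπ1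
      have e3 := mul_le_mul_of_nonneg_left hz (norm_nonneg G)
      have e4 := mul_le_mul_of_nonneg_left hzw (norm_nonneg G)
      linarith
    rcases (norm_nonneg (π - w)).eq_or_lt with h0 | h0
    · rw [← h0]; positivity
    · rw [div_div, le_div_iff₀ (by positivity)]
      refine le_of_mul_le_mul_right ?_ h0
      linarith
  refine ⟨hbound, ?_⟩
  rw [mul_div_assoc]
  refine le_trans ?_ (mul_le_mul_of_nonneg_left hbound (by positivity))
  have hsum : G π + G w + p + q = 0 := by
    have h3 := congrArg₂ (· + ·) h1 h2
    simp only [add_zero] at h3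
    rw [← h3]
    module
  have hδ := norm_nonneg (π - w)
  by_cases hlt : C * ‖π - w‖ < 1
  · obtain ⟨z, hz, hzn⟩ := hC π w p q hp hq hsum hlt
    refine (Metric.infDist_le_dist_of_mem hz).trans ?_
    rw [dist_eq_norm]
    nlinarith
  -- Here any critical point `e` will do: both points lie in the unit ball, so their distance is at
  -- most `2 ≤ 3C‖π - w‖`.
  · refine (Metric.infDist_le_dist_of_mem he).trans ?_
    have hee : ‖e‖ ≤ 1 := by
      obtain ⟨p', hp', -⟩ := he
      exact GW.norm_le_one_of_mem_blockSet hμ1 hp'.1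
    have h3 : ‖(1 / 2 : ℝ) • (π + w)‖ ≤ 1 := by
      rw [norm_smul]
      norm_num
      linarith [norm_add_le π w]
    rw [dist_eq_norm]
    linarith [norm_sub_le ((1 / 2 : ℝ) • (π + w)) e]
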